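/- Let $d\ge 2$, $n\ge 0$ be integers and let $X : L(\mathbb{C}^d)\to L(\mathbb{C}^n)$ be a quantum channel (a completely positive, trace-preserving linear map). Assume that: (i) $X$ is universally covariant: there are unitary representations $U$ of $SU(d)$ on $\mathbb{C}^d$, which is the defining representation or its complex conjugate up to unitary equivalence, and $V$ of $SU(d)$ on $\mathbb{C}^n$, such that $X(U_g\rho U_g^\dagger)=V_gX(\rho)V_g^\dagger$ for every $g\in SU(d)$ and every state $\rho$; (ii) $X$ is commutativity-preserving: $[X(\rho),X(\sigma)]=0$ for all states $\rho,\sigma$ with $[\rho,\sigma]=0$. Let $|0\rangle,\dots,|d-1\rangle$ be the standard basis of $\mathbb{C}^d$. For $\omega\in\mathbb{R}$ put $\Gamma_\omega(\rho_0,\rho_1)=\frac{1+\omega}{2}\rho_0-\frac{1-\omega}{2}\rho_1$, and let $\|A\|_1=\operatorname{Tr}\sqrt{A^\dagger A}$. A binary conditional probability distribution $p=(p_{j|i})_{i,j\in\{1,2\}}$ ($p_{j|i}\ge 0$, $\sum_j p_{j|i}=1$ for each $i$) is called compatible with $X$ if there are states $\rho_1,\rho_2$ on $\mathbb{C}^d$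 and a two-outcome POVM $\{\pi_1,\pi_2\}$ on $\mathbb{C}^n$ with $p_{j|i}=\operatorname{Tr}[X(\rho_i)\pi_j]$ for all $i,j$. Then $X(|0\rangle\langle0|)$ and $X(|1\rangle\langle1|)$ have a common orthonormal basis of eigenvectors. Moreover, for every such basis $(v_k)_k$, with $X(|0\rangle\langle0|)v_k=a_kv_k$ and $X(|1\rangle\langle1|)v_k=b_kv_k$, put $\alpha_k=\frac{a_k+b_k}{2}$, $\beta_k=\frac{a_k-b_k}{2}$ and, when $\alpha_k\neq0$, $\gamma_k=\beta_k/\alpha_k$. Then a binary conditional probability distribution $p$ is compatible with $X$ if and only if both $$|p_{1|1}-p_{1|2}|\le\sum_k|\beta_k|$$ and $$|p_{1|1}-p_{1|2}|\le\left\|X\big(\Gamma_{\gamma_k}(|0\rangle\langle0|,|1\rangle\langle1|)\big)\right\|_1-\gamma_k\,|p_{1|1}-p_{2|2}|$$ for every $k$ with $\alpha_k\neq0$ and $\gamma_k\in[-1,1]$. -/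

import Mathlib

open scoped Matrix MatrixOrder ComplexOrder Matrix.Norms.L2Operator CStarAlgebra ComplexConjugate

/-- The algebra `L(ℂᵈ)` of linear operators on the `d`-dimensional Hilbert space, as matrices in a
fixed orthonormal basis `|0⟩, …, |d - 1⟩`. -/
abbrev Op (d : ℕ) : Type := Matrix (Fin d) (Fin d) ℂ

/-- A quantum channel `L(ℂᵈ) → L(ℂⁿ)`: a completely positive, trace preserving linear map. -/
structure QuantumChannel (d n : ℕ) extends Op d →CP Op n where
  /-- Preservation of the trace. -/
  trace_preserving : ∀ A : Op d, (toLinearMap A).trace = A.trace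

/-- A channel acts on operators. -/
noncomputable instance instCoeFunQuantumChannel (d n : ℕ) :
    CoeFun (QuantumChannel d n) (fun _ => Op d → Op n) :=
  ⟨fun X => X.toCompletelyPositiveMap⟩

/-- Quantum states (density matrices): positive semidefinite operators of unit trace. -/
def IsState {d : ℕ} (ρ : Op d) : Prop := ρ.PosSemidef ∧ ρ.trace = 1

/-- Positive operator-valued measures with `s` outcomes. -/
def IsPOVM {s d : ℕ} (π : Fin s → Op d) : Prop := (∀ j, (π j).PosSemidef) ∧ ∑ j, π j = 1

/-- `p j i` is the probability `p_{j|i}` of the output `j` given the input `i`; labels are counted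
from `0`. -/
def IsCondProb {r s : ℕ} (p : Fin s → Fin r → ℝ) : Prop :=
  (∀ j i, 0 ≤ p j i) ∧ ∀ i, ∑ j, p j i = 1

/-- The channel `X` is compatible with `p`: there are states `ρ_i` and a POVM `π_j` such that
`p_{j|i} = Tr[X(ρ_i) π_j]`. -/
def Compatible {d n r s : ℕ} (X : QuantumChannel d n) (p : Fin s → Fin r → ℝ) : Prop :=
  ∃ (ρ : Fin r → Op d) (π : Fin s → Op n), (∀ i, IsState (ρ i)) ∧ IsPOVM π ∧
    ∀ j i, (p j i : ℂ) = (X (ρ i) * π j).trace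

/-- Up to a change of orthonormal basis, `U` is the defining representation `g ↦ g` of `SU(d)` on
`ℂᵈ` or its complex conjugate `g ↦ ḡ`. These are all the nontrivial unitary representations of
`SU(d)` on a `d`-dimensional space. -/
def IsDefiningOrConjugate {d : ℕ}
    (U : Matrix.specialUnitaryGroup (Fin d) ℂ →* Matrix.unitaryGroup (Fin d) ℂ) : Prop :=
  ∃ W ∈ Matrix.unitaryGroup (Fin d) ℂ,
    (∀ g, (U g : Op d) = W * (g : Op d) * Wᴴ) ∨
    (∀ g, (U g : Op d) = W * (g : Op d).map conj * Wᴴ)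

/-- Universal covariance: `X(U_g ρ U_g†) = V_g X(ρ) V_g†` for all `g ∈ SU(d)` and all states `ρ`,
with `U` the representation of `SU(d)` on the input space and `V` some unitary representation of
`SU(d)` on the output space. -/
def UniversallyCovariant {d n : ℕ} (X : QuantumChannel d n) : Prop :=
  ∃ (U : Matrix.specialUnitaryGroup (Fin d) ℂ →* Matrix.unitaryGroup (Fin d) ℂ)
    (V : Matrix.specialUnitaryGroup (Fin d) ℂ →* Matrix.unitaryGroup (Fin n) ℂ),
    IsDefiningOrConjugate U ∧
    ∀ g, ∀ ρ : Op d, IsState ρ →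
      X ((U g : Op d) * ρ * (U g : Op d)ᴴ) = (V g : Op n) * X ρ * (V g : Op n)ᴴ

/-- `X` maps commuting states to commuting states. -/
def CommutativityPreserving {d n : ℕ} (X : QuantumChannel d n) : Prop :=
  ∀ ρ σ : Op d, IsState ρ → IsState σ → Commute ρ σ → Commute (X ρ) (X σ)

/-- The projector `|i⟩⟨i|` on a vector of the fixed orthonormal basis. -/
def ketbra {d : ℕ} (i : Fin d) : Op d := Matrix.single i i 1

/-- The Helstrom matrix `Γ_ω(A, B) = (1 + ω)/2 A - (1 - ω)/2 B`. -/
noncomputable def helstrom {d : ℕ} (ω : ℝ) (A B : Op d) : Op d :=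
  (((1 + ω) / 2 : ℝ) : ℂ) • A - (((1 - ω) / 2 : ℝ) : ℂ) • B

/-- The trace norm `‖A‖₁ = Tr |A|`, where `|A| = (A†A)^{1/2}`. -/
noncomputable def traceNorm {n : ℕ} (A : Op n) : ℝ := (CFC.abs A).trace.re

/-- `v` is an orthonormal basis of common eigenvectors of `A` and `B`; the `k`-th vector belongs to
the eigenvalue `a k` of `A` and to the eigenvalue `b k` of `B`. -/
def IsCommonEigenbasis {n : ℕ} (A B : Op n)
    (v : OrthonormalBasis (Fin n) ℂ (EuclideanSpace ℂ (Fin n))) (a b : Fin n → ℝ) : Prop :=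
  ∀ k, Matrix.toEuclideanLin A (v k) = (a k : ℂ) • v k ∧
    Matrix.toEuclideanLin B (v k) = (b k : ℂ) • v k

/-! Write `x = p 0 0`, `y = p 0 1`. By duality the expectation of an effect after `X` is `Tr(Aρ)`
with `A` Hermitian, and since `d ≥ 2` its extreme values `hi`, `lo` occur at two orthogonal
eigenvectors of `A`. Covariance carries this pair to the first two basis states at the price of
rotating the effect. In a common eigenbasis of the two outputs only the diagonal `t` of the rotated
effect counts, so `(hi, lo) = ∑ t k • (a k, b k)` with `t k ∈ [0, 1]`: a point of the zonotope `Z`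
generated by the `(a k, b k)`.

Covariance under the exchange of the two states makes `Z` symmetric about the diagonal, and `Z`
contains `(0, 0)` and `(1, 1)`; by convexity it contains the square `[lo, hi]²`. Hence the
compatible pairs `(x, y)` are exactly the points of `Z`.

By its support function, `Z` is cut out of the unit square by `|x - y| + ω|x + y - 1| ≤ ∑ |β k - ω α
k|` for `ω ∈ [0, 1]`, whose right side is the trace norm of the image of `Γ_ω`. The left side is
affine in `ω` and the right side is affine between consecutive breakpoints `γ k`, so endpoints and
breakpoints suffice. The endpoint `0` is the first inequality of the theorem, and the endpoint `1`
is automatic. -/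

/-! ### Planar zonotopes and their support functions. -/

section Zonotope

variable {ι : Type*} [Fintype ι]

/-- An affine function lies below the piecewise affine function `ω ↦ ∑ |β - ω α|` on `[0, 1]` as
soon as it does so at the end points and at the breakpoints. -/
theorem le_sum_abs_sub_mul_of_breakpoints (α β : ι → ℝ) (C D : ℝ)
    (h0 : C ≤ ∑ k, |β k|) (h1 : C + D ≤ ∑ k, |β k - α k|)
    (hk : ∀ k, α k ≠ 0 → β k / α k ∈ Set.Ioo 0 1 →
      C + β k / α k * D ≤ ∑ j, |β j - β k / α k * α j|)
    {ω : ℝ} (hω : ω ∈ Set.Icc 0 1) : C + ω * D ≤ ∑ k, |β k - ω * α k| := by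
  classical
  set S : Finset ℝ := {0, 1} ∪ (Finset.univ.filter fun k => α k ≠ 0 ∧ β k / α k ∈ Set.Ioo 0 1).image
    (fun k => β k / α k) with hS
  have hSg : ∀ s ∈ S, C + s * D ≤ ∑ k, |β k - s * α k| := by
    intro s hs
    simp only [hS, Finset.mem_union, Finset.mem_insert, Finset.mem_singleton, Finset.mem_image,
      Finset.mem_filter, Finset.mem_univ, true_and] at hs
    rcases hs with (rfl | rfl) | ⟨k, ⟨hα, hk'⟩, rfl⟩
    · simpa using h0
    · simpa using h1
    · exact hk k hα hk'
  have h0S : (0 : ℝ) ∈ S := by simp [hS]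
  have h1S : (1 : ℝ) ∈ S := by simp [hS]
  have hSI : ∀ k, α k ≠ 0 → β k / α k ∈ Set.Ioo 0 1 → β k / α k ∈ S := fun k ha hb => by
    simp only [hS, Finset.mem_union, Finset.mem_image, Finset.mem_filter, Finset.mem_univ,
      true_and]
    exact Or.inr ⟨k, ⟨ha, hb⟩, rfl⟩
  -- `l` and `r` are the neighbours of `ω` in `S`. No breakpoint lies strictly between them, so no
  -- term changes sign on `[l, r]` and the sum is affine there.
  obtain ⟨l, hl, hlmax⟩ := (S.filter (· ≤ ω)).exists_max_image id
    ⟨0, Finset.mem_filter.2 ⟨h0S, hω.1⟩⟩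
  obtain ⟨r, hr, hrmin⟩ := (S.filter (ω ≤ ·)).exists_min_image id
    ⟨1, Finset.mem_filter.2 ⟨h1S, hω.2⟩⟩
  rw [Finset.mem_filter] at hl hr
  have hl0 : 0 ≤ l := hlmax 0 (Finset.mem_filter.2 ⟨h0S, hω.1⟩)
  have hr1 : r ≤ 1 := hrmin 1 (Finset.mem_filter.2 ⟨h1S, hω.2⟩)
  have hsign : ∀ j, 0 ≤ (β j - l * α j) * (β j - r * α j) := by
    intro j
    by_contra! hneg
    have hα : α j ≠ 0 := by
      intro h
      simp only [h, mul_zero, sub_zero] at hneg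
      nlinarith [mul_self_nonneg (β j)]
    have hβ : β j = β j / α j * α j := by field_simp
    set γ := β j / α j with hγ
    have hprod : (γ - l) * (γ - r) < 0 := by
      rw [hβ] at hneg
      have : (γ - l) * (γ - r) * (α j * α j) < 0 := by linarith
      by_contra! h
      exact absurd this (not_lt.2 (mul_nonneg h (mul_self_nonneg _)))
    have hlr : l ≤ r := hl.2.trans hr.2
    have hlγ : l < γ := by
      by_contra! h
      nlinarith
    have hγr : γ < r := by
      by_contra! h
      nlinarith
    have hγS : γ ∈ S := hSI j hα ⟨by linarith, by linarith⟩
    rcases le_total γ ω with h | h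
    · exact absurd (hlmax γ (Finset.mem_filter.2 ⟨hγS, h⟩)) (not_le.2 hlγ)
    · exact absurd (hrmin γ (Finset.mem_filter.2 ⟨hγS, h⟩)) (not_le.2 hγr)
  obtain ⟨s, t, hs, ht, hst, rfl⟩ : ω ∈ segment ℝ l r := by
    rw [segment_eq_Icc (hl.2.trans hr.2)]
    exact ⟨hl.2, hr.2⟩
  have hsum : ∑ k, |β k - (s • l + t • r) * α k| =
      s * ∑ k, |β k - l * α k| + t * ∑ k, |β k - r * α k| := by
    rw [Finset.mul_sum, Finset.mul_sum, ← Finset.sum_add_distrib]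
    refine Finset.sum_congr rfl fun j _ => ?_
    have : β j - (s • l + t • r) * α j = s * (β j - l * α j) + t * (β j - r * α j) := by
      simp only [smul_eq_mul]
      linear_combination (-(β j)) * hst
    rw [this, ← abs_of_nonneg hs, ← abs_of_nonneg ht, ← abs_mul, ← abs_mul, abs_of_nonneg hs,
      abs_of_nonneg ht]
    refine (abs_add_eq_add_abs_iff _ _).2 ?_
    rcases mul_nonneg_iff.1 (hsign j) with h | h
    · exact Or.inl ⟨mul_nonneg hs h.1, mul_nonneg ht h.2⟩
    · exact Or.inr ⟨mul_nonpos_of_nonneg_of_nonpos hs h.1, mul_nonpos_of_nonneg_of_nonpos ht h.2⟩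
  rw [hsum]
  have e1 := mul_le_mul_of_nonneg_left (hSg l hl.1) hs
  have e2 := mul_le_mul_of_nonneg_left (hSg r hr.1) ht
  have : C + (s • l + t • r) * D = s * (C + l * D) + t * (C + r * D) := by
    simp only [smul_eq_mul]
    linear_combination (-C) * hst
  linarith

/-- A point of the plane belongs to the zonotope generated by the vectors `(a k, b k)` if all linear
functionals are at most the support function of the zonotope there. -/
theorem exists_weights_of_le_support (a b : ι → ℝ) (x y : ℝ)
    (h : ∀ c e : ℝ, 2 * (c * x + e * y) ≤
      ∑ k, (c * a k + e * b k) + ∑ k, |c * a k + e * b k|) :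
    ∃ t : ι → ℝ, (∀ k, t k ∈ Set.Icc 0 1) ∧ ∑ k, t k * a k = x ∧ ∑ k, t k * b k = y := by
  classical
  let F : (ι → ℝ) →ₗ[ℝ] ℝ × ℝ :=
    { toFun := fun t => (∑ k, t k * a k, ∑ k, t k * b k)
      map_add' := fun s t => by simp [add_mul, Finset.sum_add_distrib]
      map_smul' := fun r t => by simp [Finset.mul_sum, mul_assoc] }
  set K : Set (ℝ × ℝ) := F '' Set.Icc 0 1 with hK
  by_contra hcon
  have hxy : (x, y) ∉ K := by
    rintro ⟨t, ht, hF⟩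
    exact hcon ⟨t, fun k => ⟨ht.1 k, ht.2 k⟩, congrArg Prod.fst hF, congrArg Prod.snd hF⟩
  have hconv : Convex ℝ K := (convex_Icc 0 1).linear_image F
  have hclosed : IsClosed K :=
    (isCompact_Icc.image F.continuous_of_finiteDimensional).isClosed
  obtain ⟨f, u, hf, hu⟩ := geometric_hahn_banach_closed_point hconv hclosed hxy
  have hfe : ∀ p q : ℝ, f (p, q) = f (1, 0) * p + f (0, 1) * q := fun p q => by
    have : ((p, q) : ℝ × ℝ) = p • (1, 0) + q • (0, 1) := by simp
    rw [this, map_add, map_smul, map_smul, smul_eq_mul, smul_eq_mul]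
    ring
  set c := f (1, 0)
  set e := f (0, 1)
  -- The vertex of the cube maximising `f ∘ F`. Its value is the support function, because `2 * max
  -- u 0 = u + |u|`.
  let t : ι → ℝ := fun k => if 0 ≤ c * a k + e * b k then 1 else 0
  have ht : F t ∈ K := Set.mem_image_of_mem F
    ⟨fun k => by dsimp only [t]; split_ifs <;> simp, fun k => by dsimp only [t]; split_ifs <;> simp⟩
  have h1 := hf _ ht
  have h2 : f (F t) = c * ∑ k, t k * a k + e * ∑ k, t k * b k := hfe _ _
  have h3 : 2 * (c * ∑ k, t k * a k + e * ∑ k, t k * b k) =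
      ∑ k, (c * a k + e * b k) + ∑ k, |c * a k + e * b k| := by
    rw [Finset.mul_sum, Finset.mul_sum, ← Finset.sum_add_distrib, ← Finset.sum_add_distrib,
      Finset.mul_sum]
    refine Finset.sum_congr rfl fun k _ => ?_
    dsimp only [t]
    split_ifs with hk
    · rw [abs_of_nonneg hk]; ring
    · rw [abs_of_neg (not_le.1 hk)]; ring
  rw [hfe] at hu
  linarith [h c e]

/-- The pairs `(x, y)` in the zonotope generated by `(α k + β k, α k - β k)`, for a zonotope
symmetric under exchange of the coordinates and with top vertex `(1, 1)`. -/
theorem exists_weights_of_le_sum_abs (α β : ι → ℝ) (hα : ∑ k, α k = 1) (hβ : ∑ k, β k = 0)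
    (hsymm : ∀ ω, ∑ k, |β k + ω * α k| = ∑ k, |β k - ω * α k|) {x y : ℝ}
    (hx : x ∈ Set.Icc 0 1) (hy : y ∈ Set.Icc 0 1)
    (h : ∀ ω ∈ Set.Icc (0 : ℝ) 1, |x - y| + ω * |x + y - 1| ≤ ∑ k, |β k - ω * α k|) :
    ∃ t : ι → ℝ, (∀ k, t k ∈ Set.Icc 0 1) ∧
      ∑ k, t k * (α k + β k) = x ∧ ∑ k, t k * (α k - β k) = y := by
  refine exists_weights_of_le_support _ _ _ _ fun c e => ?_
  have hsum : ∑ k, (c * (α k + β k) + e * (α k - β k)) = c + e := by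
    have : ∀ k, c * (α k + β k) + e * (α k - β k) = (c + e) * α k + (c - e) * β k :=
      fun k => by ring
    rw [Finset.sum_congr rfl fun k _ => this k, Finset.sum_add_distrib, ← Finset.mul_sum,
      ← Finset.mul_sum, hα, hβ]
    ring
  have habs : |c + e| ≤ ∑ k, |c * (α k + β k) + e * (α k - β k)| := by
    rw [← hsum]
    exact Finset.abs_sum_le_sum_abs _ _
  rw [hsum]
  suffices hs : c * (2 * x - 1) + e * (2 * y - 1) ≤
      ∑ k, |c * (α k + β k) + e * (α k - β k)| by linarith
  -- Strictly opposite signs of `c` and `e` give a hypothesis with `ω = |c + e| / |c - e|`.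
  -- Otherwise the functional is monotone in the same sense in both coordinates, and the unit square
  -- already gives the bound `|c + e|`.
  by_cases hce : |c + e| < |c - e|
  · have hpos : 0 < |c - e| := (abs_nonneg _).trans_lt hce
    have hω : |c + e| / |c - e| ∈ Set.Icc (0 : ℝ) 1 :=
      ⟨by positivity, (div_le_one hpos).2 hce.le⟩
    have key : ∑ k, |c * (α k + β k) + e * (α k - β k)| =
        |c - e| * ∑ k, |β k - |c + e| / |c - e| * α k| := by
      have hne : c - e ≠ 0 := abs_pos.1 hpos
      have hsplit : ∀ k, |c * (α k + β k) + e * (α k - β k)| =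
          |c - e| * |β k + (c + e) / (c - e) * α k| := fun k => by
        rw [← abs_mul]
        congr 1
        field_simp
        ring
      rw [Finset.sum_congr rfl fun k _ => hsplit k, ← Finset.mul_sum, ← abs_div]
      rcases abs_choice ((c + e) / (c - e)) with h' | h'
      · rw [h', hsymm]
      · rw [h']
        simp
    rw [key]
    have := mul_le_mul_of_nonneg_left (h _ hω) hpos.le
    refine le_trans ?_ this
    have e1 : |c - e| * (|x - y| + |c + e| / |c - e| * |x + y - 1|) =
        |(c - e) * (x - y)| + |(c + e) * (x + y - 1)| := by
      rw [abs_mul, abs_mul]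
      field_simp
    rw [e1]
    have := le_abs_self ((c - e) * (x - y))
    have := le_abs_self ((c + e) * (x + y - 1))
    linarith
  · refine le_trans ?_ habs
    obtain ⟨hx0, hx1⟩ := hx
    obtain ⟨hy0, hy1⟩ := hy
    have hle := not_lt.1 hce
    rcases abs_cases (c + e) with ⟨h1, h2⟩ | ⟨h1, h2⟩ <;>
    rw [h1] at hle ⊢ <;>
    have := abs_le.1 hle
    · have hc : 0 ≤ c := by linarith
      have he : 0 ≤ e := by linarith
      nlinarith
    · have hc : c ≤ 0 := by linarith
      have he : e ≤ 0 := by linarith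
      nlinarith

/-- Pairs of numbers between the coordinates of a point of the zonotope satisfy the inequalities
defining the zonotope. -/
theorem abs_sub_add_mul_abs_le (α β t : ι → ℝ) (hα : ∑ k, α k = 1) (hβ : ∑ k, β k = 0)
    (hsymm : ∀ ω, ∑ k, |β k + ω * α k| = ∑ k, |β k - ω * α k|)
    (ht : ∀ k, t k ∈ Set.Icc 0 1) {x y : ℝ}
    (hx : x ∈ Set.Icc (∑ k, t k * (α k - β k)) (∑ k, t k * (α k + β k)))
    (hy : y ∈ Set.Icc (∑ k, t k * (α k - β k)) (∑ k, t k * (α k + β k)))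
    {ω : ℝ} (hω : ω ∈ Set.Icc (0 : ℝ) 1) :
    |x - y| + ω * |x + y - 1| ≤ ∑ k, |β k - ω * α k| := by
  -- Termwise `(2t - 1)u ≤ |u|`. At `s = ±ω` this bounds `(hi - lo) ± ω(hi + lo - 1)`, where `hi`
  -- and `lo` are the ends of the interval.
  have key : ∀ s : ℝ, 2 * ∑ k, t k * (β k + s * α k) - s ≤ ∑ k, |β k + s * α k| := by
    intro s
    have hs : s = ∑ k, (β k + s * α k) := by
      rw [Finset.sum_add_distrib, ← Finset.mul_sum, hα, hβ]
      ring
    calc 2 * ∑ k, t k * (β k + s * α k) - s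
        = 2 * ∑ k, t k * (β k + s * α k) - ∑ k, (β k + s * α k) := by rw [← hs]
      _ = ∑ k, (2 * (t k * (β k + s * α k)) - (β k + s * α k)) := by
        rw [Finset.mul_sum, Finset.sum_sub_distrib]
      _ ≤ ∑ k, |β k + s * α k| := ?_
    refine Finset.sum_le_sum fun k _ => ?_
    obtain ⟨h0, h1⟩ := ht k
    rcases abs_cases (β k + s * α k) with ⟨h2, h3⟩ | ⟨h2, h3⟩ <;> rw [h2] <;> nlinarith
  have k1 := key ω
  have k2 := key (-ω)
  rw [hsymm] at k1
  rw [hsymm] at k2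
  have hneg : ∑ k, |β k - -ω * α k| = ∑ k, |β k - ω * α k| := by
    simpa [sub_eq_add_neg] using hsymm ω
  rw [hneg] at k2
  have hsplit : ∀ s : ℝ, ∑ k, t k * (β k + s * α k) =
      ∑ k, t k * β k + s * ∑ k, t k * α k := fun s => by
    rw [Finset.mul_sum, ← Finset.sum_add_distrib]
    exact Finset.sum_congr rfl fun k _ => by ring
  have hp : ∑ k, t k * (α k + β k) = ∑ k, t k * α k + ∑ k, t k * β k := by
    simp [mul_add, Finset.sum_add_distrib]
  have hm : ∑ k, t k * (α k - β k) = ∑ k, t k * α k - ∑ k, t k * β k := by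
    simp [mul_sub, Finset.sum_sub_distrib]
  rw [hsplit] at k1 k2
  rw [hp, hm] at hx hy
  obtain ⟨hx0, hx1⟩ := hx
  obtain ⟨hy0, hy1⟩ := hy
  obtain ⟨hω0, hω1⟩ := hω
  -- For each choice of signs the left side is affine in `x` and `y` with coefficients `±(1 + ω)`
  -- and `±(1 - ω)`, of opposite signs, so its maximum over the square is at `(hi, lo)` or `(lo,
  -- hi)`.
  have m1 := mul_le_mul_of_nonneg_left hx0 (sub_nonneg.2 hω1)
  have m2 := mul_le_mul_of_nonneg_left hy0 (sub_nonneg.2 hω1)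
  have m3 := mul_le_mul_of_nonneg_left hx1 (sub_nonneg.2 hω1)
  have m4 := mul_le_mul_of_nonneg_left hy1 (sub_nonneg.2 hω1)
  have m5 := mul_le_mul_of_nonneg_left hx0 hω0
  have m6 := mul_le_mul_of_nonneg_left hy0 hω0
  have m7 := mul_le_mul_of_nonneg_left hx1 hω0
  have m8 := mul_le_mul_of_nonneg_left hy1 hω0
  rcases abs_cases (x - y) with ⟨h1, _⟩ | ⟨h1, _⟩ <;>
  rcases abs_cases (x + y - 1) with ⟨h2, _⟩ | ⟨h2, _⟩ <;>
  rw [h1, h2] <;> linarith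

end Zonotope

/-! ### Simultaneous diagonalization and the trace norm. -/

section Diagonalization

variable {n : ℕ}

/-- Two commuting Hermitian matrices have a common orthonormal eigenbasis. -/
theorem exists_isCommonEigenbasis {A B : Op n} (hA : A.IsHermitian) (hB : B.IsHermitian)
    (hAB : Commute A B) : ∃ v a b, IsCommonEigenbasis A B v a b := by
  classical
  have hA' := Matrix.isSymmetric_toEuclideanLin_iff.2 hA
  have hB' := Matrix.isSymmetric_toEuclideanLin_iff.2 hB
  have hcomm : Commute (Matrix.toEuclideanLin A) (Matrix.toEuclideanLin B) := by
    ext1 x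
    simp [Matrix.toLpLin_apply, Matrix.mulVec_mulVec, hAB.eq]
  have hint := LinearMap.IsSymmetric.directSum_isInternal_of_commute hA' hB' hcomm
  -- The joint eigenspaces are indexed by all of `ℂ × ℂ`, the second coordinate belonging to `A`.
  -- Restricting to the nonzero ones, finitely many by independence, gives a finite family to which
  -- an orthonormal basis can be subordinate.
  have hort := LinearMap.IsSymmetric.orthogonalFamily_eigenspace_inf_eigenspace hA' hB'
  have hfin := WellFoundedGT.finite_ne_bot_of_iSupIndep hint.submodule_iSupIndep
  have : Fintype {i : ℂ × ℂ // Module.End.eigenspace (Matrix.toEuclideanLin A) i.2 ⊓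
    Module.End.eigenspace (Matrix.toEuclideanLin B) i.1 ≠ ⊥} := hfin.fintype
  have hint' := DirectSum.isInternal_ne_bot_iff.2 hint
  have hort' := hort.comp (f := fun i : {i : ℂ × ℂ //
    Module.End.eigenspace (Matrix.toEuclideanLin A) i.2 ⊓
      Module.End.eigenspace (Matrix.toEuclideanLin B) i.1 ≠ ⊥} => i.1) Subtype.val_injective
  have hn : Module.finrank ℂ (EuclideanSpace ℂ (Fin n)) = n := finrank_euclideanSpace_fin
  let v := hint'.subordinateOrthonormalBasis hn hort'
  have hv := fun k => hint'.subordinateOrthonormalBasis_subordinate hn k hort'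
  have hne : ∀ k, v k ≠ 0 := fun k => v.orthonormal.ne_zero k
  have hvA := fun k => (Submodule.mem_inf.1 (hv k)).1
  have hvB := fun k => (Submodule.mem_inf.1 (hv k)).2
  refine ⟨v, fun k => (hint'.subordinateOrthonormalBasisIndex hn k hort').1.2.re,
    fun k => (hint'.subordinateOrthonormalBasisIndex hn k hort').1.1.re, fun k => ⟨?_, ?_⟩⟩
  · rw [Complex.conj_eq_iff_re.1 (hA'.conj_eigenvalue_eq_self
      (Module.End.hasEigenvalue_of_hasEigenvector ⟨hvA k, hne k⟩))]
    exact Module.End.mem_eigenspace_iff.1 (hvA k)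
  · rw [Complex.conj_eq_iff_re.1 (hB'.conj_eigenvalue_eq_self
      (Module.End.hasEigenvalue_of_hasEigenvector ⟨hvB k, hne k⟩))]
    exact Module.End.mem_eigenspace_iff.1 (hvB k)

/-- A common eigenbasis diagonalizes both matrices by the same unitary. -/
theorem IsCommonEigenbasis.exists_unitary {A B : Op n}
    {v : OrthonormalBasis (Fin n) ℂ (EuclideanSpace ℂ (Fin n))} {a b : Fin n → ℝ}
    (h : IsCommonEigenbasis A B v a b) :
    ∃ W ∈ Matrix.unitaryGroup (Fin n) ℂ,
      A = W * Matrix.diagonal (fun k => (a k : ℂ)) * Wᴴ ∧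
      B = W * Matrix.diagonal (fun k => (b k : ℂ)) * Wᴴ := by
  let W : Op n := Matrix.of fun i k => v k i
  have hW : Wᴴ * W = 1 := by
    ext i j
    have := orthonormal_iff_ite.1 v.orthonormal i j
    rw [Matrix.one_apply, ← this, PiLp.inner_apply, Matrix.mul_apply]
    exact Finset.sum_congr rfl fun k _ => by
      simp [W, Matrix.conjTranspose_apply, mul_comm]
  have hW' : W * Wᴴ = 1 := mul_eq_one_comm.1 hW
  have key : ∀ (C : Op n) (c : Fin n → ℝ),
      (∀ k, Matrix.toEuclideanLin C (v k) = (c k : ℂ) • v k) →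
      C = W * Matrix.diagonal (fun k => (c k : ℂ)) * Wᴴ := by
    intro C c hc
    have : C * W = W * Matrix.diagonal (fun k => (c k : ℂ)) := by
      ext i k
      have := congrArg (fun w => w i) (hc k)
      rw [Matrix.mul_diagonal, Matrix.mul_apply]
      simpa [W, Matrix.toLpLin_apply, Matrix.mulVec, dotProduct, mul_comm] using this
    rw [← this, mul_assoc, hW', mul_one]
  exact ⟨W, Matrix.mem_unitaryGroup_iff'.2 hW, key A a fun k => (h k).1, key B b fun k => (h k).2⟩

/-- The trace norm of a Hermitian matrix is the sum of the moduli of its eigenvalues. -/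
theorem traceNorm_unitary_conj_diagonal {W : Op n} (hW : W ∈ Matrix.unitaryGroup (Fin n) ℂ)
    (c : Fin n → ℝ) :
    traceNorm (W * Matrix.diagonal (fun k => (c k : ℂ)) * Wᴴ) = ∑ k, |c k| := by
  have hW1 : Wᴴ * W = 1 := Matrix.mem_unitaryGroup_iff'.1 hW
  have hmul : ∀ D E : Op n, (W * D * Wᴴ) * (W * E * Wᴴ) = W * (D * E) * Wᴴ := fun D E => by
    calc (W * D * Wᴴ) * (W * E * Wᴴ) = W * D * (Wᴴ * W) * E * Wᴴ := by noncomm_ring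
      _ = W * (D * E) * Wᴴ := by rw [hW1]; noncomm_ring
  have habs : CFC.abs (W * Matrix.diagonal (fun k => (c k : ℂ)) * Wᴴ) =
      W * Matrix.diagonal (fun k => ((|c k| : ℝ) : ℂ)) * Wᴴ := by
    refine CFC.sqrt_unique ?_ ?_
    · rw [hmul, Matrix.star_eq_conjTranspose, Matrix.conjTranspose_mul, Matrix.conjTranspose_mul,
        Matrix.conjTranspose_conjTranspose, ← mul_assoc W (_ᴴ), hmul, Matrix.diagonal_conjTranspose,
        Matrix.diagonal_mul_diagonal, Matrix.diagonal_mul_diagonal]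
      congr 3
      ext k
      simp only [Pi.star_apply, RCLike.star_def, Complex.conj_ofReal]
      rw [← Complex.ofReal_mul, ← Complex.ofReal_mul, abs_mul_abs_self]
    · rw [Matrix.nonneg_iff_posSemidef]
      refine Matrix.PosSemidef.mul_mul_conjTranspose_same ?_ W
      refine Matrix.PosSemidef.diagonal fun k => ?_
      simp
  rw [traceNorm, habs, Matrix.trace_mul_cycle, hW1, one_mul, Matrix.trace_diagonal]
  simp

/-- Unitarily equivalent diagonalized matrices have the same sum of moduli of eigenvalues. -/
theorem sum_abs_eq_of_unitary_conj_diagonal {V : Op n} (hV : V ∈ Matrix.unitaryGroup (Fin n) ℂ)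
    {W : Op n} (hW : W ∈ Matrix.unitaryGroup (Fin n) ℂ) {c e : Fin n → ℝ}
    (h : W * Matrix.diagonal (fun k => (c k : ℂ)) * Wᴴ =
      V * (W * Matrix.diagonal (fun k => (e k : ℂ)) * Wᴴ) * Vᴴ) :
    ∑ k, |c k| = ∑ k, |e k| := by
  rw [← traceNorm_unitary_conj_diagonal hW, ← traceNorm_unitary_conj_diagonal (mul_mem hV hW), h,
    Matrix.conjTranspose_mul]
  simp only [mul_assoc]

/-- Expectation values in a state diagonal with respect to `W`. -/
theorem trace_unitary_conj_diagonal_mul (W π : Op n) (a : Fin n → ℝ) :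
    (W * Matrix.diagonal (fun k => (a k : ℂ)) * Wᴴ * π).trace =
      ∑ k, (a k : ℂ) * (Wᴴ * π * W) k k := by
  rw [show W * Matrix.diagonal (fun k => (a k : ℂ)) * Wᴴ * π =
    W * (Matrix.diagonal (fun k => (a k : ℂ)) * (Wᴴ * π)) by noncomm_ring, Matrix.trace_mul_comm,
    mul_assoc, Matrix.trace]
  simp only [Matrix.diag_apply, Matrix.diagonal_mul]

/-- The diagonal entries of an effect lie between `0` and `1`. -/
theorem exists_diag_eq_of_posSemidef {E : Op n} (h0 : E.PosSemidef) (h1 : (1 - E).PosSemidef)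
    (k : Fin n) : ∃ t ∈ Set.Icc (0 : ℝ) 1, E k k = t := by
  have e0 := h0.diag_nonneg (i := k)
  have e1 := h1.diag_nonneg (i := k)
  simp only [Matrix.sub_apply, Matrix.one_apply_eq] at e1
  rw [Complex.le_def] at e0 e1
  simp only [Complex.zero_re, Complex.zero_im, Complex.sub_re, Complex.one_re] at e0 e1
  exact ⟨(E k k).re, ⟨e0.1, by linarith [e1.1]⟩, Complex.ext rfl (by simpa using e0.2.symm)⟩

end Diagonalization

/-! ### From covariance under `SU(d)` to arbitrary orthogonal pairs of pure states. -/

section Covariance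

variable {d n : ℕ}

theorem isState_ketbra (i : Fin d) : IsState (ketbra i) := by
  refine ⟨?_, by simp [ketbra]⟩
  rw [ketbra, ← Matrix.diagonal_single]
  refine Matrix.PosSemidef.diagonal fun k => ?_
  by_cases h : k = i
  · subst h; simp
  · simp [Pi.single_eq_of_ne h]

/-- Every unitary is, up to a phase, an element of the special unitary group. -/
theorem exists_specialUnitary_eq_smul (hd : d ≠ 0) {Q : Op d}
    (hQ : Q ∈ Matrix.unitaryGroup (Fin d) ℂ) :
    ∃ (z : ℂ) (g : Matrix.specialUnitaryGroup (Fin d) ℂ), z * conj z = 1 ∧ (g : Op d) = z • Q := by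
  have hdet : Q.det * conj Q.det = 1 := Unitary.mul_star_self_of_mem (Matrix.det_of_mem_unitary hQ)
  -- This root makes `det (z • Q) = z ^ d * det Q = 1`.
  obtain ⟨z, hz⟩ := IsAlgClosed.exists_pow_nat_eq (conj Q.det) (Nat.pos_of_ne_zero hd)
  have hnorm : z * conj z = 1 := by
    have h1 : ‖Q.det‖ = 1 := by
      have : ‖Q.det‖ ^ 2 = 1 := by
        rw [← Complex.ofReal_inj]
        simpa [Complex.mul_conj'] using hdet
      exact (pow_eq_one_iff_of_nonneg (norm_nonneg _) two_ne_zero).1 this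
    have h2 : ‖z‖ ^ d = 1 := by
      rw [← norm_pow, hz, RCLike.norm_conj, h1]
    rw [Complex.mul_conj', (pow_eq_one_iff_of_nonneg (norm_nonneg _) hd).1 h2]
    simp
  refine ⟨z, ⟨z • Q, Matrix.mem_specialUnitaryGroup_iff.2 ⟨?_, ?_⟩⟩, hnorm, rfl⟩
  · rw [Matrix.mem_unitaryGroup_iff, Matrix.star_eq_conjTranspose, Matrix.conjTranspose_smul,
      smul_mul_smul_comm]
    rw [Matrix.mem_unitaryGroup_iff, Matrix.star_eq_conjTranspose] at hQ
    rw [hQ, Complex.star_def, hnorm, one_smul]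
  · rw [Matrix.det_smul, Fintype.card_fin, hz, mul_comm, hdet]

/-- A defining or conjugate representation reaches every unitary up to a phase. -/
theorem IsDefiningOrConjugate.exists_eq_smul (hd : d ≠ 0)
    {U : Matrix.specialUnitaryGroup (Fin d) ℂ →* Matrix.unitaryGroup (Fin d) ℂ}
    (hU : IsDefiningOrConjugate U) {Q : Op d} (hQ : Q ∈ Matrix.unitaryGroup (Fin d) ℂ) :
    ∃ (z : ℂ) (g : Matrix.specialUnitaryGroup (Fin d) ℂ), z * conj z = 1 ∧ (U g : Op d) = z • Q := by
  obtain ⟨W, hW, h⟩ := hU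
  have hWW : W * Wᴴ = 1 := Matrix.mem_unitaryGroup_iff.1 hW
  have hR : Wᴴ * Q * W ∈ Matrix.unitaryGroup (Fin d) ℂ :=
    mul_mem (mul_mem (Unitary.star_mem hW) hQ) hW
  have hback : ∀ z : ℂ, W * (z • (Wᴴ * Q * W)) * Wᴴ = z • Q := fun z => by
    rw [Matrix.mul_smul, Matrix.smul_mul]
    congr 1
    calc W * (Wᴴ * Q * W) * Wᴴ = (W * Wᴴ) * Q * (W * Wᴴ) := by noncomm_ring
      _ = Q := by rw [hWW, one_mul, mul_one]
  rcases h with h | h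
  · obtain ⟨z, g, hz, hg⟩ := exists_specialUnitary_eq_smul hd hR
    exact ⟨z, g, hz, by rw [h, hg, hback]⟩
  · have hconj : ∀ M : Op d, M.map conj = (Mᴴ)ᵀ := fun M => by
      ext i j
      simp
    -- The representation conjugates entries, so the group element is sought near the conjugate of
    -- the target; the phase comes back conjugated.
    have hR' : (Wᴴ * Q * W).map conj ∈ Matrix.unitaryGroup (Fin d) ℂ := by
      have := Matrix.mem_unitaryGroup_iff.1 hR
      rw [Matrix.star_eq_conjTranspose] at this
      have hct : ((Wᴴ * Q * W)ᴴᵀ)ᴴ = (Wᴴ * Q * W)ᵀ := by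
        ext i j
        rw [Matrix.conjTranspose_apply, Matrix.transpose_apply, Matrix.conjTranspose_apply,
          star_star, Matrix.transpose_apply]
      rw [Matrix.mem_unitaryGroup_iff', Matrix.star_eq_conjTranspose, hconj, hct,
        ← Matrix.transpose_mul, mul_eq_one_comm.1 this, Matrix.transpose_one]
    obtain ⟨z, g, hz, hg⟩ := exists_specialUnitary_eq_smul hd hR'
    refine ⟨conj z, g, by rw [Complex.conj_conj, mul_comm, hz], ?_⟩
    rw [h, hg, ← hback]
    congr 2
    ext i j
    simp only [Matrix.map_apply, Matrix.smul_apply, smul_eq_mul, map_mul, Complex.conj_conj]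

/-- A universally covariant channel is covariant with respect to every unitary. -/
theorem UniversallyCovariant.exists_unitary (hd : d ≠ 0) {X : QuantumChannel d n}
    (hX : UniversallyCovariant X) {Q : Op d} (hQ : Q ∈ Matrix.unitaryGroup (Fin d) ℂ) :
    ∃ V ∈ Matrix.unitaryGroup (Fin n) ℂ, ∀ ρ, IsState ρ → X (Q * ρ * Qᴴ) = V * X ρ * Vᴴ := by
  obtain ⟨U, V, hU, hcov⟩ := hX
  obtain ⟨z, g, hz, hg⟩ := hU.exists_eq_smul hd hQ
  refine ⟨V g, (V g).2, fun ρ hρ => ?_⟩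
  rw [← hcov g ρ hρ, hg, Matrix.conjTranspose_smul, Matrix.smul_mul, Matrix.smul_mul,
    Matrix.mul_smul, smul_smul, Complex.star_def, hz, one_smul]

theorem submatrix_id_perm_mem_unitaryGroup {U : Op d} (hU : U ∈ Matrix.unitaryGroup (Fin d) ℂ)
    (σ : Equiv.Perm (Fin d)) : U.submatrix id σ ∈ Matrix.unitaryGroup (Fin d) ℂ := by
  rw [Matrix.mem_unitaryGroup_iff', Matrix.star_eq_conjTranspose] at hU ⊢
  rw [Matrix.conjTranspose_submatrix, ← Matrix.submatrix_mul _ _ _ _ _ Function.bijective_id, hU,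
    Matrix.submatrix_one_equiv]

/-- Permuting columns absorbs the choice of eigenvectors into the unitary, so every pair of columns
can be reached from one fixed pair of basis states. -/
theorem submatrix_id_perm_conj_ketbra (U : Op d) (σ : Equiv.Perm (Fin d)) (i : Fin d) :
    U.submatrix id σ * ketbra i * (U.submatrix id σ)ᴴ = U * ketbra (σ i) * Uᴴ := by
  ext a b
  simp [ketbra, Matrix.mul_apply, Matrix.single_apply, Finset.sum_ite_eq, ite_and]

theorem exists_perm_apply_eq_and {i₀ i₁ i j : Fin d} (h₀ : i₀ ≠ i₁) (h : i ≠ j) :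
    ∃ σ : Equiv.Perm (Fin d), σ i₀ = i ∧ σ i₁ = j := by
  -- The inner swap places `i₀`; the outer one corrects the image of `i₁` and fixes `i`, which is
  -- neither that image nor `j`.
  refine ⟨Equiv.swap (Equiv.swap i₀ i i₁) j * Equiv.swap i₀ i, ?_, ?_⟩
  · rw [Equiv.Perm.mul_apply, Equiv.swap_apply_left]
    refine Equiv.swap_apply_of_ne_of_ne (fun h' => h₀ ?_) h
    apply (Equiv.swap i₀ i).injective
    rw [Equiv.swap_apply_left, ← h']
  · rw [Equiv.Perm.mul_apply, Equiv.swap_apply_left]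

/-- Any two orthogonal pure states are mapped by a universally covariant channel to a unitary
transform of the images of two fixed basis states. -/
theorem UniversallyCovariant.exists_unitary_pair (hd : d ≠ 0) {X : QuantumChannel d n}
    (hX : UniversallyCovariant X) {U : Op d} (hU : U ∈ Matrix.unitaryGroup (Fin d) ℂ)
    {i₀ i₁ i j : Fin d} (h₀ : i₀ ≠ i₁) (h : i ≠ j) :
    ∃ V ∈ Matrix.unitaryGroup (Fin n) ℂ,
      X (U * ketbra i * Uᴴ) = V * X (ketbra i₀) * Vᴴ ∧
      X (U * ketbra j * Uᴴ) = V * X (ketbra i₁) * Vᴴ := by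
  obtain ⟨σ, rfl, rfl⟩ := exists_perm_apply_eq_and h₀ h
  obtain ⟨V, hV, hcov⟩ := hX.exists_unitary hd (submatrix_id_perm_mem_unitaryGroup hU σ)
  refine ⟨V, hV, ?_, ?_⟩
  · rw [← submatrix_id_perm_conj_ketbra, hcov _ (isState_ketbra _)]
  · rw [← submatrix_id_perm_conj_ketbra, hcov _ (isState_ketbra _)]

end Covariance

/-! ### Heisenberg picture and extremal expectations. -/

section Expectation

variable {d n : ℕ}

/-- The Heisenberg picture: expectations after the channel are expectations of a Hermitian matrix
before it. -/
theorem QuantumChannel.exists_isHermitian_trace_eq (X : QuantumChannel d n) {π : Op n}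
    (hπ : π.IsHermitian) :
    ∃ A : Op d, A.IsHermitian ∧ ∀ ρ, (X ρ * π).trace = (A * ρ).trace := by
  -- The indices are exchanged because `Tr(A E_ji) = A_ij`.
  refine ⟨Matrix.of fun i j => (X (Matrix.single j i 1) * π).trace, ?_, fun ρ => ?_⟩
  · ext i j
    have hstar : (X (Matrix.single i j 1))ᴴ = X (Matrix.single j i 1) := by
      rw [← Matrix.star_eq_conjTranspose, ← map_star X.toCompletelyPositiveMap,
        Matrix.star_eq_conjTranspose, Matrix.conjTranspose_single, star_one]
    rw [Matrix.conjTranspose_apply, Matrix.of_apply, Matrix.of_apply, ← Matrix.trace_conjTranspose,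
      Matrix.conjTranspose_mul, hπ.eq, hstar, Matrix.trace_mul_comm]
  · let L : Op d →ₗ[ℂ] ℂ :=
      Matrix.traceLinearMap (Fin n) ℂ ℂ ∘ₗ LinearMap.mulRight ℂ π ∘ₗ X.toLinearMap
    have hL : ∀ M, L M = (X M * π).trace := fun M => rfl
    rw [← hL]
    conv_lhs => rw [Matrix.matrix_eq_sum_single ρ]
    rw [map_sum, Matrix.trace_mul_comm, Matrix.trace]
    refine Finset.sum_congr rfl fun i _ => ?_
    rw [map_sum, Matrix.diag_apply, Matrix.mul_apply]
    refine Finset.sum_congr rfl fun j _ => ?_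
    rw [Matrix.of_apply, ← hL, ← mul_one (ρ i j), ← smul_eq_mul (ρ i j) 1, ← Matrix.smul_single,
      map_smul, smul_eq_mul, smul_eq_mul, mul_one]

/-- The extreme values of an expectation after the channel are attained on a pair of orthogonal pure
states. -/
theorem QuantumChannel.exists_orthogonal_extremal (hd : 2 ≤ d) (X : QuantumChannel d n) {π : Op n}
    (hπ : π.IsHermitian) :
    ∃ U ∈ Matrix.unitaryGroup (Fin d) ℂ, ∃ (i j : Fin d) (hi lo : ℝ), i ≠ j ∧
      (X (U * ketbra i * Uᴴ) * π).trace = hi ∧ (X (U * ketbra j * Uᴴ) * π).trace = lo ∧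
      ∀ ρ, IsState ρ → ∃ r ∈ Set.Icc lo hi, (X ρ * π).trace = r := by
  obtain ⟨A, hA, htr⟩ := X.exists_isHermitian_trace_eq hπ
  set U : Op d := hA.eigenvectorUnitary.1 with hUdef
  have hU : U ∈ Matrix.unitaryGroup (Fin d) ℂ := hA.eigenvectorUnitary.2
  have hUU : Uᴴ * U = 1 := Matrix.mem_unitaryGroup_iff'.1 hU
  have hUU' : U * Uᴴ = 1 := Matrix.mem_unitaryGroup_iff.1 hU
  have hspec : A = U * Matrix.diagonal (fun k => (hA.eigenvalues k : ℂ)) * Uᴴ := by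
    conv_lhs => rw [hA.spectral_theorem, Unitary.conjStarAlgAut_apply]
    rfl
  have hexp : ∀ ρ, (X ρ * π).trace = ∑ k, (hA.eigenvalues k : ℂ) * (Uᴴ * ρ * U) k k := fun ρ => by
    rw [htr]
    conv_lhs => rw [hspec]
    exact trace_unitary_conj_diagonal_mul _ _ _
  have heig : ∀ i, (X (U * ketbra i * Uᴴ) * π).trace = hA.eigenvalues i := fun i => by
    rw [hexp, show Uᴴ * (U * ketbra i * Uᴴ) * U = (Uᴴ * U) * ketbra i * (Uᴴ * U) by noncomm_ring,
      hUU, one_mul, mul_one]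
    simp [ketbra, Matrix.single_apply]
  obtain ⟨i, -, hi⟩ := Finset.univ.exists_max_image hA.eigenvalues ⟨⟨0, by omega⟩, by simp⟩
  -- Minimising away from `i` keeps the two eigenvectors distinct even when `A` is scalar; this
  -- needs `2 ≤ d`.
  have hne : (Finset.univ.erase i).Nonempty := by
    rw [← Finset.card_pos, Finset.card_erase_of_mem (Finset.mem_univ _), Finset.card_univ,
      Fintype.card_fin]
    omega
  obtain ⟨j, hj, hjmin⟩ := (Finset.univ.erase i).exists_min_image hA.eigenvalues hne
  have hmin : ∀ k, hA.eigenvalues j ≤ hA.eigenvalues k := fun k => by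
    by_cases hk : k = i
    · subst hk
      exact hi j (Finset.mem_univ _)
    · exact hjmin k (Finset.mem_erase.2 ⟨hk, Finset.mem_univ _⟩)
  refine ⟨U, hU, i, j, hA.eigenvalues i, hA.eigenvalues j, (Finset.ne_of_mem_erase hj).symm,
    heig i, heig j, fun ρ hρ => ?_⟩
  -- The diagonal of `ρ` in the eigenbasis of `A` is a probability vector, so the expectation is a
  -- convex combination of eigenvalues.
  have hpos : (Uᴴ * ρ * U).PosSemidef := hρ.1.conjTranspose_mul_mul_same U
  have hq : ∀ k, ((Uᴴ * ρ * U) k k).re = (Uᴴ * ρ * U) k k ∧ 0 ≤ ((Uᴴ * ρ * U) k k).re := fun k => by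
    have := hpos.diag_nonneg (i := k)
    rw [Complex.le_def] at this
    exact ⟨Complex.ext rfl this.2, this.1⟩
  have hqsum : ∑ k, ((Uᴴ * ρ * U) k k).re = 1 := by
    have h1 : (Uᴴ * ρ * U).trace = 1 := by
      rw [Matrix.trace_mul_cycle, hUU', one_mul, hρ.2]
    rw [← Complex.re_sum]
    exact congrArg Complex.re h1
  refine ⟨∑ k, hA.eigenvalues k * ((Uᴴ * ρ * U) k k).re, ⟨?_, ?_⟩, ?_⟩
  · calc hA.eigenvalues j = ∑ k, hA.eigenvalues j * ((Uᴴ * ρ * U) k k).re := by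
          rw [← Finset.mul_sum, hqsum, mul_one]
      _ ≤ _ := Finset.sum_le_sum fun k _ => mul_le_mul_of_nonneg_right (hmin k) (hq k).2
  · calc _ ≤ ∑ k, hA.eigenvalues i * ((Uᴴ * ρ * U) k k).re :=
          Finset.sum_le_sum fun k _ => mul_le_mul_of_nonneg_right (hi k (Finset.mem_univ _)) (hq k).2
      _ = hA.eigenvalues i := by rw [← Finset.mul_sum, hqsum, mul_one]
  · rw [hexp, Complex.ofReal_sum]
    exact Finset.sum_congr rfl fun k _ => by rw [Complex.ofReal_mul, (hq k).1]

end Expectation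

/-! ### Compatibility as membership in the zonotope of output eigenvalues. -/

section Compatibility

variable {d n : ℕ}

theorem unitary_conj_diagonal_linear (W : Op n) (a b : Fin n → ℝ) (s t : ℂ) (c : Fin n → ℝ)
    (hc : ∀ k, (c k : ℂ) = s * a k + t * b k) :
    W * Matrix.diagonal (fun k => (c k : ℂ)) * Wᴴ =
      s • (W * Matrix.diagonal (fun k => (a k : ℂ)) * Wᴴ) +
        t • (W * Matrix.diagonal (fun k => (b k : ℂ)) * Wᴴ) := by
  have : Matrix.diagonal (fun k => (c k : ℂ)) =
      s • Matrix.diagonal (fun k => (a k : ℂ)) + t • Matrix.diagonal (fun k => (b k : ℂ)) := by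
    rw [← Matrix.diagonal_smul, ← Matrix.diagonal_smul, Matrix.diagonal_add]
    congr 1
    ext k
    simp [hc]
  rw [this, mul_add, add_mul, Matrix.mul_smul, Matrix.mul_smul, Matrix.smul_mul, Matrix.smul_mul]

theorem trace_unitary_conj_diagonal {W : Op n} (hW : W ∈ Matrix.unitaryGroup (Fin n) ℂ)
    (a : Fin n → ℝ) :
    (W * Matrix.diagonal (fun k => (a k : ℂ)) * Wᴴ).trace = ((∑ k, a k : ℝ) : ℂ) := by
  have hWW : Wᴴ * W = 1 := Matrix.mem_unitaryGroup_iff'.1 hW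
  rw [Matrix.trace_mul_cycle, hWW, one_mul, Matrix.trace_diagonal, Complex.ofReal_sum]

/-- The spectrum of the image of a Helstrom matrix under a universally covariant channel is, up to
sign, symmetric under exchange of the two states. -/
theorem UniversallyCovariant.sum_abs_symm (hd : d ≠ 0) {X : QuantumChannel d n}
    (hX : UniversallyCovariant X) {i₀ i₁ : Fin d} (h₀ : i₀ ≠ i₁) {W : Op n}
    (hW : W ∈ Matrix.unitaryGroup (Fin n) ℂ) {a b : Fin n → ℝ}
    (ha : X (ketbra i₀) = W * Matrix.diagonal (fun k => (a k : ℂ)) * Wᴴ)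
    (hb : X (ketbra i₁) = W * Matrix.diagonal (fun k => (b k : ℂ)) * Wᴴ) (ω : ℝ) :
    ∑ k, |(a k - b k) / 2 + ω * ((a k + b k) / 2)| =
      ∑ k, |(a k - b k) / 2 - ω * ((a k + b k) / 2)| := by
  -- With the identity as unitary and the pair reversed, `V` exchanges the two output states.
  obtain ⟨V, hV, h1, h2⟩ := hX.exists_unitary_pair hd (one_mem _) h₀ h₀.symm
  simp only [one_mul, Matrix.conjTranspose_one, mul_one] at h1 h2
  have key := sum_abs_eq_of_unitary_conj_diagonal hV hW
    (c := fun k => (a k - b k) / 2 + ω * ((a k + b k) / 2))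
    (e := fun k => (b k - a k) / 2 + ω * ((a k + b k) / 2)) ?_
  · rw [key]
    refine Finset.sum_congr rfl fun k _ => ?_
    rw [← abs_neg]
    congr 1
    ring
  · rw [unitary_conj_diagonal_linear W a b (1 / 2 + ω / 2) (-1 / 2 + ω / 2)
      (fun k => (a k - b k) / 2 + ω * ((a k + b k) / 2))
      (fun k => by push_cast; ring),
      unitary_conj_diagonal_linear W a b (-1 / 2 + ω / 2) (1 / 2 + ω / 2)
      (fun k => (b k - a k) / 2 + ω * ((a k + b k) / 2))
      (fun k => by push_cast; ring), ← ha, ← hb, mul_add, add_mul, Matrix.mul_smul, Matrix.mul_smul,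
      Matrix.smul_mul, Matrix.smul_mul, ← h1, ← h2, add_comm]

/-- Since `Γ_ω(A, B) = (A - B)/2 + ω (A + B)/2`, its image is diagonal in the common eigenbasis. -/
theorem QuantumChannel.traceNorm_helstrom (X : QuantumChannel d n) {A B : Op d} {W : Op n}
    (hW : W ∈ Matrix.unitaryGroup (Fin n) ℂ) {a b : Fin n → ℝ}
    (ha : X A = W * Matrix.diagonal (fun k => (a k : ℂ)) * Wᴴ)
    (hb : X B = W * Matrix.diagonal (fun k => (b k : ℂ)) * Wᴴ) (ω : ℝ) :
    traceNorm (X (helstrom ω A B)) = ∑ k, |(a k - b k) / 2 + ω * ((a k + b k) / 2)| := by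
  rw [← traceNorm_unitary_conj_diagonal hW, helstrom, map_sub, map_smul, map_smul, ha, hb,
    unitary_conj_diagonal_linear W a b ((((1 + ω) / 2 : ℝ) : ℂ)) (-(((1 - ω) / 2 : ℝ) : ℂ))
      (fun k => (a k - b k) / 2 + ω * ((a k + b k) / 2))
      (fun k => by push_cast; ring), neg_smul, sub_eq_add_neg]

theorem QuantumChannel.sum_eigenvalues_eq_one (X : QuantumChannel d n) {ρ : Op d} (hρ : IsState ρ)
    {W : Op n} (hW : W ∈ Matrix.unitaryGroup (Fin n) ℂ) {a : Fin n → ℝ}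
    (ha : X ρ = W * Matrix.diagonal (fun k => (a k : ℂ)) * Wᴴ) : ∑ k, a k = 1 := by
  have h1 : (X ρ).trace = 1 := (X.trace_preserving _).trans hρ.2
  rw [ha, trace_unitary_conj_diagonal hW] at h1
  exact_mod_cast h1

/-- A binary distribution is compatible with a universally covariant channel that diagonalizes two
basis states simultaneously iff it satisfies the inequalities that cut out the zonotope of the pairs
of output eigenvalues. -/
theorem UniversallyCovariant.compatible_iff (hd : 2 ≤ d) {X : QuantumChannel d n}
    (hX : UniversallyCovariant X) {i₀ i₁ : Fin d} (h₀ : i₀ ≠ i₁) {W : Op n}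
    (hW : W ∈ Matrix.unitaryGroup (Fin n) ℂ) {a b : Fin n → ℝ}
    (ha : X (ketbra i₀) = W * Matrix.diagonal (fun k => (a k : ℂ)) * Wᴴ)
    (hb : X (ketbra i₁) = W * Matrix.diagonal (fun k => (b k : ℂ)) * Wᴴ)
    {p : Fin 2 → Fin 2 → ℝ} (hp : IsCondProb p) :
    Compatible X p ↔ ∀ ω ∈ Set.Icc (0 : ℝ) 1,
      |p 0 0 - p 0 1| + ω * |p 0 0 + p 0 1 - 1| ≤
        ∑ k, |(a k - b k) / 2 - ω * ((a k + b k) / 2)| := by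
  have hd0 : d ≠ 0 := by omega
  have hsymm := hX.sum_abs_symm hd0 h₀ hW ha hb
  have hsa := X.sum_eigenvalues_eq_one (isState_ketbra _) hW ha
  have hsb := X.sum_eigenvalues_eq_one (isState_ketbra _) hW hb
  have hα : ∑ k, (a k + b k) / 2 = 1 := by
    rw [← Finset.sum_div, Finset.sum_add_distrib, hsa, hsb]
    norm_num
  have hβ : ∑ k, (a k - b k) / 2 = 0 := by
    rw [← Finset.sum_div, Finset.sum_sub_distrib, hsa, hsb]
    norm_num
  have hab : ∀ k, (a k + b k) / 2 + (a k - b k) / 2 = a k := fun k => by ring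
  have hab' : ∀ k, (a k + b k) / 2 - (a k - b k) / 2 = b k := fun k => by ring
  have hp1 : ∀ i, p 1 i = 1 - p 0 i := fun i => by
    have := hp.2 i
    rw [Fin.sum_univ_two] at this
    linarith
  constructor
  · rintro ⟨ρ, π, hρ, ⟨hπ, hπ1⟩, htr⟩ ω hω
    rw [Fin.sum_univ_two] at hπ1
    obtain ⟨U, hU, i, j, hi, lo, hij, hhi, hlo, hext⟩ :=
      X.exists_orthogonal_extremal hd (hπ 0).isHermitian
    obtain ⟨V, hV, hVi, hVj⟩ := hX.exists_unitary_pair hd0 hU h₀ hij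
    have hVW : V * W ∈ Matrix.unitaryGroup (Fin n) ℂ := mul_mem hV hW
    have hVW1 : (V * W)ᴴ * (V * W) = 1 := Matrix.mem_unitaryGroup_iff'.1 hVW
    have hE1 : (1 - (V * W)ᴴ * π 0 * (V * W)).PosSemidef := by
      have := (hπ 1).conjTranspose_mul_mul_same (V * W)
      rwa [eq_sub_of_add_eq' hπ1, mul_sub, sub_mul, mul_one, hVW1] at this
    -- The zonotope weights are the diagonal of the effect in the rotated eigenbasis `V * W`.
    choose t ht htE using exists_diag_eq_of_posSemidef
      ((hπ 0).conjTranspose_mul_mul_same (V * W)) hE1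
    have hval : ∀ (c : Fin n → ℝ) (r : ℝ),
        (V * (W * Matrix.diagonal (fun k => (c k : ℂ)) * Wᴴ) * Vᴴ * π 0).trace = r →
        r = ∑ k, t k * c k := by
      intro c r hr
      rw [show V * (W * Matrix.diagonal (fun k => (c k : ℂ)) * Wᴴ) * Vᴴ =
        V * W * Matrix.diagonal (fun k => (c k : ℂ)) * (V * W)ᴴ by
          rw [Matrix.conjTranspose_mul]; noncomm_ring, trace_unitary_conj_diagonal_mul] at hr
      rw [← Complex.ofReal_inj, ← hr, Complex.ofReal_sum]
      exact Finset.sum_congr rfl fun k _ => by rw [htE, Complex.ofReal_mul, mul_comm]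
    rw [hVi, ha] at hhi
    rw [hVj, hb] at hlo
    have hmem : ∀ i, p 0 i ∈ Set.Icc lo hi := fun i => by
      obtain ⟨r, hr, hreq⟩ := hext (ρ i) (hρ i)
      rw [← htr 0 i, Complex.ofReal_inj] at hreq
      rwa [hreq]
    rw [hval a hi hhi, hval b lo hlo] at hmem
    refine abs_sub_add_mul_abs_le (fun k => (a k + b k) / 2) (fun k => (a k - b k) / 2) t hα hβ hsymm
      ht ?_ ?_ hω
    · simpa only [hab, hab'] using hmem 0
    · simpa only [hab, hab'] using hmem 1
  · intro h
    have hmem : ∀ i, p 0 i ∈ Set.Icc (0 : ℝ) 1 := fun i =>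
      ⟨hp.1 0 i, by linarith [hp.1 1 i, hp1 i]⟩
    obtain ⟨t, ht, hta, htb⟩ := exists_weights_of_le_sum_abs (fun k => (a k + b k) / 2)
      (fun k => (a k - b k) / 2) hα hβ hsymm (hmem 0) (hmem 1) h
    simp only [hab, hab'] at hta htb
    have hWW : Wᴴ * W = 1 := Matrix.mem_unitaryGroup_iff'.1 hW
    have hWW' : W * Wᴴ = 1 := Matrix.mem_unitaryGroup_iff.1 hW
    have hpos : ∀ s : Fin n → ℝ, (∀ k, 0 ≤ s k) →
        (W * Matrix.diagonal (fun k => (s k : ℂ)) * Wᴴ).PosSemidef := fun s hs =>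
      Matrix.PosSemidef.mul_mul_conjTranspose_same
        (Matrix.PosSemidef.diagonal fun k => by simpa using hs k) W
    -- Conversely, the weights of a point of the zonotope are the eigenvalues of an effect that
    -- realises it on the two basis states.
    set π₀ : Op n := W * Matrix.diagonal (fun k => (t k : ℂ)) * Wᴴ with hπ₀
    have hπ₁ : W * Matrix.diagonal (fun k => ((1 - t k : ℝ) : ℂ)) * Wᴴ = 1 - π₀ := by
      have : Matrix.diagonal (fun k => ((1 - t k : ℝ) : ℂ)) =
          (1 : Op n) - Matrix.diagonal (fun k => (t k : ℂ)) := by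
        rw [← Matrix.diagonal_one, Matrix.diagonal_sub]
        congr 1
        ext k
        simp
      rw [this, mul_sub, sub_mul, mul_one, hWW']
    have htr : ∀ i (c : Fin n → ℝ), X (ketbra i) = W * Matrix.diagonal (fun k => (c k : ℂ)) * Wᴴ →
        (X (ketbra i) * π₀).trace = ((∑ k, t k * c k : ℝ) : ℂ) := by
      intro i c hc
      rw [hc, trace_unitary_conj_diagonal_mul, Complex.ofReal_sum]
      refine Finset.sum_congr rfl fun k _ => ?_
      rw [hπ₀, show Wᴴ * (W * Matrix.diagonal (fun k => (t k : ℂ)) * Wᴴ) * W =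
        (Wᴴ * W) * Matrix.diagonal (fun k => (t k : ℂ)) * (Wᴴ * W) by noncomm_ring, hWW, one_mul,
        mul_one, Matrix.diagonal_apply_eq, Complex.ofReal_mul, mul_comm]
    have hρtr : ∀ i, (X (ketbra i)).trace = 1 := fun i =>
      (X.trace_preserving _).trans (isState_ketbra i).2
    refine ⟨![ketbra i₀, ketbra i₁], ![π₀, 1 - π₀], ?_, ⟨?_, ?_⟩, ?_⟩
    · simp [Fin.forall_fin_two, isState_ketbra]
    · rw [Fin.forall_fin_two]
      refine ⟨hpos t fun k => (ht k).1, ?_⟩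
      simp only [Matrix.cons_val_one, Matrix.cons_val_fin_one]
      rw [← hπ₁]
      exact hpos _ fun k => sub_nonneg.2 (ht k).2
    · simp
    · simp [Fin.forall_fin_two, mul_sub, htr _ _ ha, htr _ _ hb, hta, htb, hρtr, hp1]

end Compatibility

/-! ### Reduction to finitely many inequalities. -/

theorem theorem2 {d n : ℕ} (hd : 2 ≤ d) (X : QuantumChannel d n)
    (hcov : UniversallyCovariant X) (hcomm : CommutativityPreserving X) :
    let e₀ : Op d := ketbra ⟨0, by omega⟩
    let e₁ : Op d := ketbra ⟨1, by omega⟩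
    (∃ v a b, IsCommonEigenbasis (X e₀) (X e₁) v a b) ∧
    ∀ v a b, IsCommonEigenbasis (X e₀) (X e₁) v a b →
      let α : Fin n → ℝ := fun k => (a k + b k) / 2
      let β : Fin n → ℝ := fun k => (a k - b k) / 2
      let γ : Fin n → ℝ := fun k => β k / α k
      ∀ p : Fin 2 → Fin 2 → ℝ, IsCondProb p →
        (Compatible X p ↔
          |p 0 0 - p 0 1| ≤ ∑ k, |β k| ∧
          ∀ k, α k ≠ 0 → γ k ∈ Set.Icc (-1) 1 →
            |p 0 0 - p 0 1| ≤
              traceNorm (X (helstrom (γ k) e₀ e₁)) - γ k * |p 0 0 - p 1 1|) := by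
  intro e₀ e₁
  have h₀ : (⟨0, by omega⟩ : Fin d) ≠ ⟨1, by omega⟩ := by simp
  have hherm : ∀ i : Fin d, (X (ketbra i)).IsHermitian := fun i => by
    have := map_nonneg X.toCompletelyPositiveMap
      (Matrix.nonneg_iff_posSemidef.2 (isState_ketbra i).1)
    exact (Matrix.nonneg_iff_posSemidef.1 this).isHermitian
  have hee : Commute e₀ e₁ := by
    simp only [commute_iff_eq, e₀, e₁, ketbra]
    rw [Matrix.single_mul_single_of_ne _ _ _ _ h₀, Matrix.single_mul_single_of_ne _ _ _ _ h₀.symm]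
  refine ⟨exists_isCommonEigenbasis (hherm _) (hherm _)
    (hcomm _ _ (isState_ketbra _) (isState_ketbra _) hee), ?_⟩
  intro v a b hv α β γ p hp
  obtain ⟨W, hW, ha, hb⟩ := hv.exists_unitary
  have hsymm : ∀ ω, ∑ k, |β k + ω * α k| = ∑ k, |β k - ω * α k| :=
    hcov.sum_abs_symm (by omega) h₀ hW ha hb
  have hnorm : ∀ ω, traceNorm (X (helstrom ω e₀ e₁)) = ∑ k, |β k - ω * α k| := fun ω =>
    (X.traceNorm_helstrom hW ha hb ω).trans (hsymm ω)
  have hp11 : p 0 0 - p 1 1 = p 0 0 + p 0 1 - 1 := by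
    have := hp.2 1
    rw [Fin.sum_univ_two] at this
    linarith
  rw [hcov.compatible_iff hd h₀ hW ha hb hp, hp11]
  constructor
  · intro h
    refine ⟨by simpa using h 0 (by simp), fun k _ hγ => ?_⟩
    rw [hnorm]
    rcases le_total 0 (γ k) with h0 | h0
    · linarith [h (γ k) ⟨h0, hγ.2⟩]
    -- A negative `γ k` gives an inequality weaker than the one at `-γ k`, as the sum of moduli is
    -- even in `ω`.
    · have hneg := h (-γ k) ⟨by linarith, by linarith [hγ.1]⟩
      have : ∑ j, |β j - -γ k * α j| = ∑ j, |β j - γ k * α j| := by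
        simpa [sub_eq_add_neg] using hsymm (γ k)
      rw [this] at hneg
      nlinarith [abs_nonneg (p 0 0 + p 0 1 - 1)]
  · rintro ⟨h0, hk⟩ ω hω
    refine le_sum_abs_sub_mul_of_breakpoints α β _ _ h0 ?_ (fun k hα hγ => ?_) hω
    -- At `ω = 1` the right side is `∑ |b k| ≥ 1`, while `|x - y| + |x + y - 1| ≤ 1` on the unit
    -- square.
    · have hge : 1 ≤ ∑ k, |β k - α k| := by
        calc (1 : ℝ) = ∑ k, b k := (X.sum_eigenvalues_eq_one (isState_ketbra _) hW hb).symm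
          _ ≤ ∑ k, |β k - α k| := Finset.sum_le_sum fun k _ => ?_
        have : β k - α k = -b k := by
          simp only [α, β]
          ring
        rw [this, abs_neg]
        exact le_abs_self _
      refine le_trans ?_ hge
      have := hp.1 0 0
      have := hp.1 0 1
      have := hp.1 1 0
      have := hp.1 1 1
      have s0 := hp.2 0
      have s1 := hp.2 1
      rw [Fin.sum_univ_two] at s0 s1
      rcases abs_cases (p 0 0 - p 0 1) with ⟨h1, _⟩ | ⟨h1, _⟩ <;>
      rcases abs_cases (p 0 0 + p 0 1 - 1) with ⟨h2, _⟩ | ⟨h2, _⟩ <;>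
      rw [h1, h2] <;> linarith
    · have := hk k hα ⟨by linarith [hγ.1], hγ.2.le⟩
      rw [hnorm] at this
      linarith
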